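/- **Conventions.** A code $\mathcal C\subseteq\Sigma^n$ *corrects $t$ insdel errors* if there is a decoder that recovers every $c\in\mathcal C$ from every word obtained from $c$ by at most $t$ operations, each inserting or deleting one symbol at an arbitrary position. For distinct $\alpha_1,\dots,\alpha_n\in\mathbb F_q$ and $k\le n$, the $[n,k]_q$ RS code with evaluation points $\alpha_1,\dots,\alpha_n$ is $\{(f(\alpha_1),\dots,f(\alpha_n)) : f\in\mathbb F_q[x],\ \deg f<k\}$. An $\mathbb F_3$-subspace $S$ of an extension field of $\mathbb F_3$ is a *Sidon space* if for all nonzero $a,b,c,d\in S$ with $ab=cd$ one has $\{a\mathbb F_3,b\mathbb F_3\}=\{c\mathbb F_3,d\mathbb F_3\}$. For $m\ge 1$ put $N_m=(3^m+1)/2$; a matrix $H\in\mathbb F_3^{2m\times N_m}$ is called *good* if the ternary code $\{x\in\mathbb F_3^{N_m} : Hx=0\}$ has dimension $N_m-2m$ and all its nonzero words have Hamming weight at least $5$. **Theorem.** 1. *(Every instance of the construction works.)* Let $m\ge 2$, let $S\subset\mathbb F_{3^{4m}}$ be a Sidon space over $\mathbb F_3$ with basis $s_1,\dots,s_{2m}$,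 let $H$ be a good matrix, and let $(\alpha_1,\dots,\alpha_{N_m})=(s_1,\dots,s_{2m})\cdot H$. For every $n\ge 4$ and all distinct indices $j_1,\dots,j_n\in\{1,\dots,N_m\}$, in any order, the elements $\alpha_{j_1},\dots,\alpha_{j_n}$ are distinct, and the $[n,2]_{3^{4m}}$ RS code with evaluation points $\alpha_{j_1},\dots,\alpha_{j_n}$ corrects $n-3$ insdel errors. (For $n=N_m$ and $j_i=i$ this is the full code.) 2. *(The ingredients exist, explicitly.)* Let $m\ge 1$ and let $E=\mathbb F_{3^{2m}}\subset\mathbb F_{3^{4m}}$. If $\gamma\in\mathbb F_{3^{4m}}$ is a root of a polynomial $x^2+bx+c$ that is irreducible over $E$ and whose constant term $c$ is not a square in $E$, then $S_\gamma=\{u+u^3\gamma : u\in E\}$ is a Sidon space over $\mathbb F_3$ of dimension $2m$. The field $\mathbb F_{3^{4m}}$ has a primitive element. For every primitive element $g$ of $\mathbb F_{3^{4m}}$, with $\beta=g^{(3^m-1)(3^{2m}+1)}$: the element $\gamma=g$ satisfies the condition above; the elements $\beta^i+\beta^{3i}g$ $(0\le i<2m)$ form a basis of $S_g$; the matrix $H$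 whose column $j$ $(0\le j<N_m)$ consists of the coefficients of $x^0,\dots,x^{2m-1}$ in the remainder of $x^j$ modulo the minimal polynomial of $\beta$ over $\mathbb F_3$ is good; and the resulting evaluation points are $\beta^j+\beta^{3j}g$ $(0\le j<N_m)$. 3. *(Codes of every length.)* There is an absolute constant $C$ such that for every $n\ge 4$ the least $m$ with $N_m\ge n$ satisfies $m\ge 2$ and $q:=3^{4m}\le C n^4$, and for every primitive element $g$ of $\mathbb F_q$ the first $n$ evaluation points $\beta^j+\beta^{3j}g$ $(0\le j<n)$ of part 2 are distinct and define an $[n,2]_q$ RS code that corrects $n-3$ insdel errors. -/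

import Mathlib

open Polynomial

universe u

/-- `InsDel t s w`: the word `w` can be obtained from the word `s` by exactly `t` operations, each of
which inserts one symbol or deletes one symbol, at an arbitrary position. -/
inductive InsDel {A : Type*} : ℕ → List A → List A → Prop
  | refl (s : List A) : InsDel 0 s s
  | insert {t : ℕ} {s : List A} (l r : List A) (a : A) :
      InsDel t s (l ++ r) → InsDel (t + 1) s (l ++ a :: r)
  | delete {t : ℕ} {s : List A} (l r : List A) (a : A) :
      InsDel t s (l ++ a :: r) → InsDel (t + 1) s (l ++ r)

/-- The code `C` of length `n` over the alphabet `A` can correct `t` insdel errors: there is a decoder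
that recovers every codeword `c` from every word obtained from `c` by at most `t` insertions and
deletions. -/
def CorrectsInsDel {A : Type*} {n : ℕ} (C : Set (Fin n → A)) (t : ℕ) : Prop :=
  ∃ decode : List A → (Fin n → A), ∀ c ∈ C, ∀ e ≤ t, ∀ w : List A,
    InsDel e (List.ofFn c) w → decode w = c

/-- The Reed-Solomon code with evaluation vector `α`: all vectors `(f (α 1), …, f (α n))`
with `deg f < k`. -/
def rsCode {F : Type*} [Field F] {n : ℕ} (α : Fin n → F) (k : ℕ) : Set (Fin n → F) :=
  {c | ∃ f : F[X], f.degree < (k : WithBot ℕ) ∧ c = fun j => f.eval (α j)}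

/-- Sidon spaces. Here `K ∙ a` is the line `{x • a | x ∈ K}`. -/
def IsSidonSpace {K L : Type*} [Field K] [Field L] [Algebra K L] (S : Submodule K L) : Prop :=
  ∀ a ∈ S, ∀ b ∈ S, ∀ c ∈ S, ∀ d ∈ S, a ≠ 0 → b ≠ 0 → c ≠ 0 → d ≠ 0 → a * b = c * d →
    ({Submodule.span K {a}, Submodule.span K {b}} : Set (Submodule K L)) =
      {Submodule.span K {c}, Submodule.span K {d}}

/-- `s` is a basis of the subspace `S` over `K`. -/
def IsBasisOf {K L ι : Type*} [Field K] [Field L] [Algebra K L] (s : ι → L)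
    (S : Submodule K L) : Prop :=
  LinearIndependent K s ∧ Submodule.span K (Set.range s) = S

/-- The Roth-Raviv-Tamo condition, with base field of order `3`, on an element `γ` of a field of order
`3 ^ (4 * m)`. The elements `u` with `u ^ 3 ^ (2 * m) = u` form the subfield `E` of order
`3 ^ (2 * m)`; `γ` is a root of a polynomial `X ^ 2 + b X + c` with `b, c ∈ E` that is irreducible over
`E` (as `γ ∉ E`), where `c` is not a square in `E`. -/
def IsRRTElement {F : Type*} [Field F] (m : ℕ) (γ : F) : Prop :=
  γ ^ 3 ^ (2 * m) ≠ γ ∧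
    ∃ b c : F, b ^ 3 ^ (2 * m) = b ∧ c ^ 3 ^ (2 * m) = c ∧ γ ^ 2 + b * γ + c = 0 ∧
      ∀ y : F, y ^ 3 ^ (2 * m) = y → y ^ 2 ≠ c

/-- The subspace `{u + u ^ 3 * γ | u ∈ E}`, where `E = {u | u ^ 3 ^ (2 * m) = u}` is the subfield of
order `3 ^ (2 * m)`. -/
def rrtSpace {F : Type*} [Field F] [Algebra (ZMod 3) F] (m : ℕ) (γ : F) :
    Submodule (ZMod 3) F where
  carrier := {x | ∃ u : F, u ^ 3 ^ (2 * m) = u ∧ x = u + u ^ 3 * γ}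
  zero_mem' := ⟨0, by simp, by simp⟩
  add_mem' := by
    have : CharP F 3 := charP_of_injective_algebraMap (algebraMap (ZMod 3) F).injective 3
    have : ExpChar F 3 := ExpChar.prime Nat.prime_three
    rintro _ _ ⟨u, hu, rfl⟩ ⟨v, hv, rfl⟩
    refine ⟨u + v, by rw [add_pow_expChar_pow, hu, hv], ?_⟩
    rw [add_pow_expChar]; ring
  smul_mem' := by
    rintro a _ ⟨u, hu, rfl⟩
    have h3 : a ^ 3 = a := ZMod.pow_card a
    have hp : ∀ k : ℕ, a ^ 3 ^ k = a := fun k => ZMod.pow_card_pow a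
    refine ⟨a • u, by rw [_root_.smul_pow, hp, hu], ?_⟩
    rw [_root_.smul_pow, h3, smul_add, smul_mul_assoc]

/-- `H` is a `2m × N` parity-check matrix of a ternary linear `[N, N - 2m]` code of minimum distance at
least `5`: the code `{x | H x = 0}` has dimension `N - 2m`, and all its nonzero words have Hamming
weight at least `5`. -/
def IsGoodParityCheck {m N : ℕ} (H : Matrix (Fin (2 * m)) (Fin N) (ZMod 3)) : Prop :=
  Module.finrank (ZMod 3) (LinearMap.ker H.mulVecLin) + 2 * m = N ∧
    ∀ x : Fin N → ZMod 3, H.mulVec x = 0 → x ≠ 0 → 5 ≤ hammingNorm x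

/-- The vector `(s₁, …, s_{2m}) · H`. -/
def evalPoints {F : Type*} [Field F] [Algebra (ZMod 3) F] {r N : ℕ} (s : Fin r → F)
    (H : Matrix (Fin r) (Fin N) (ZMod 3)) (j : Fin N) : F :=
  ∑ i, s i * algebraMap (ZMod 3) F (H i j)

/-- The power `β` of `g`; it has order `3 ^ m + 1` when `g` is a primitive element of a field of order
`3 ^ (4 * m)`. -/
def betaElt {F : Type*} [Field F] (m : ℕ) (g : F) : F :=
  g ^ ((3 ^ m - 1) * (3 ^ (2 * m) + 1))

/-- The vectors `β ^ i + (β ^ i) ^ 3 * g`, for `0 ≤ i < 2m`. -/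
def explicitBasis {F : Type*} [Field F] (m : ℕ) (g : F) (i : Fin (2 * m)) : F :=
  betaElt m g ^ (i : ℕ) + (betaElt m g ^ (i : ℕ)) ^ 3 * g

/-- The matrix whose column `j` holds the coefficients of `X ^ j` modulo the minimal polynomial of `β`
over the field with three elements, for `0 ≤ j < (3 ^ m + 1) / 2`. -/
noncomputable def explicitMatrix {F : Type*} [Field F] [Algebra (ZMod 3) F] (m : ℕ) (g : F) :
    Matrix (Fin (2 * m)) (Fin ((3 ^ m + 1) / 2)) (ZMod 3) :=
  fun i j => ((X : (ZMod 3)[X]) ^ (j : ℕ) %ₘ minpoly (ZMod 3) (betaElt m g)).coeff i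

/-!
# Two-dimensional Reed-Solomon codes correcting `n - 3` insertions and deletions

A code corrects `n - 3` insdel errors as soon as distinct codewords have no common subsequence of
length `3` (`correctsInsDel_of_common_sublist`). For nonconstant affine functions such a common
subsequence, at increasing positions `i` and `j`, forces
`(α i₀ - α i₁) (α j₁ - α j₂) = (α i₁ - α i₂) (α j₀ - α j₁)`, so it suffices that this equation
implies `i₀ = j₀` and `i₁ = j₁` (`correctsInsDel_rsCode_two`). When the `α j` lie in a Sidon space the
equation says that two differences agree up to sign, and this is a linear relation over the
field with three elements between at most four of the `α j`. The columns of a good parity-check matrix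
admit no nontrivial relation of that kind, which proves the first part
(`IsSidonSpace.correctsInsDel`).

For the explicit ingredients, let `E` be the subfield of order `Q = 3 ^ (2 * m)`. Comparing the
coordinates of a product `(u + u ^ 3 γ) (v + v ^ 3 γ)` in the `E`-basis `1, γ` recovers `u v` and
`u ^ 2 + v ^ 2`, hence the pair `u, v` up to order and sign (`IsRRTElement.isSidonSpace`). A primitive
element `g` qualifies as `γ`, because its norm to `E` generates the cyclic group of even order
`Q - 1` and so is not a square. The power `β` of `g` has order `3 ^ m + 1`, modulo which `3` has order
`2 * m`; hence the powers of `β` below `2 * m` form a basis of `E`. In this basis the columns of the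
explicit matrix are the coordinates of `β ^ j`, and the code is negacyclic with
the zeros `β ^ t` for `t = -3, -1, 1, 3`; the BCH bound gives minimum distance at least `5`
(`IsPrimitiveRoot.five_le_hammingNorm`). The evaluation points are then the images of the `β ^ j` under
the linear map `u ↦ u + u ^ 3 g`.

Minimality of `m` in the third part means `3 ^ (m - 1) + 1 < 2 * n`, so `3 ^ (4 * m) ≤ 6 ^ 4 * n ^ 4`.
-/

/-! ### Words at bounded insertion-deletion distance -/

namespace InsDel

variable {A : Type*} {s w v : List A} {t r : ℕ}

theorem trans (h : InsDel t s w) (h' : InsDel r w v) : InsDel (t + r) s v := by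
  induction h' with
  | refl => exact h
  | insert l r a _ ih => exact .insert l r a (ih h)
  | delete l r a _ ih => exact .delete l r a (ih h)

theorem symm (h : InsDel t s w) : InsDel t w s := by
  induction h with
  | refl s => exact .refl s
  | insert l r a _ ih =>
    rw [Nat.add_comm]
    exact (InsDel.delete l r a (.refl _)).trans ih
  | delete l r a _ ih =>
    rw [Nat.add_comm]
    exact (InsDel.insert l r a (.refl _)).trans ih

/-- The easy half of the relation between insertion-deletion distance and longest common
subsequences. -/
theorem exists_common_sublist (h : InsDel t s w) :
    ∃ z : List A, z.Sublist s ∧ z.Sublist w ∧ s.length + w.length ≤ t + 2 * z.length := by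
  induction h with
  | refl s => exact ⟨s, .refl s, .refl s, by omega⟩
  | insert l r a _ ih =>
    obtain ⟨z, hs, hw, hz⟩ := ih
    refine ⟨z, hs, hw.trans ((List.sublist_cons_self a r).append_left l), ?_⟩
    simp only [List.length_append, List.length_cons] at hz ⊢
    omega
  | delete l r a _ ih =>
    obtain ⟨z, hs, hw, hz⟩ := ih
    obtain ⟨z₁, z₂, rfl, h₁, h₂⟩ := List.sublist_append_iff.1 hw
    rcases List.sublist_cons_iff.1 h₂ with h₂ | ⟨z₃, rfl, h₃⟩
    · refine ⟨z₁ ++ z₂, hs, h₁.append h₂, ?_⟩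
      simp only [List.length_append, List.length_cons] at hz ⊢
      omega
    · refine ⟨z₁ ++ z₃, ((List.sublist_cons_self a z₃).append_left z₁).trans hs,
        h₁.append h₃, ?_⟩
      simp only [List.length_append, List.length_cons] at hz ⊢
      omega

end InsDel

/-- A code corrects `t` insdel errors if distinct codewords have no common subsequence of length
`n - t`. -/
theorem correctsInsDel_of_common_sublist {A : Type*} [Nonempty A] {n t : ℕ} {C : Set (Fin n → A)}
    (h : ∀ c ∈ C, ∀ c' ∈ C, ∀ z : List A, z.Sublist (List.ofFn c) → z.Sublist (List.ofFn c') →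
      n ≤ t + z.length → c = c') : CorrectsInsDel C t := by
  classical
  refine ⟨fun w => if hw : ∃ c ∈ C, ∃ e ≤ t, InsDel e (List.ofFn c) w then hw.choose
    else fun _ => Classical.arbitrary A, fun c hc e he w hcw => ?_⟩
  have hw : ∃ c ∈ C, ∃ e ≤ t, InsDel e (List.ofFn c) w := ⟨c, hc, e, he, hcw⟩
  obtain ⟨hc', e', he', hcw'⟩ := hw.choose_spec
  obtain ⟨z, hz, hz', hlen⟩ := (hcw'.trans hcw.symm).exists_common_sublist
  simp only [List.length_ofFn] at hlen
  exact (dif_pos hw).trans (h _ hc' _ hc z hz hz' (by omega))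

/-- The positions in a word of the first `k` symbols of a subsequence. -/
theorem List.Sublist.exists_strictMono_ofFn {A : Type*} {n k : ℕ} {c : Fin n → A} {z : List A}
    (h : z.Sublist (List.ofFn c)) (hk : k ≤ z.length) :
    ∃ i : Fin k → Fin n, StrictMono i ∧ ∀ a, c (i a) = z.get (Fin.castLE hk a) := by
  obtain ⟨f, hf⟩ := List.sublist_iff_exists_fin_orderEmbedding_get_eq.1 h
  refine ⟨fun a => Fin.cast (by simp) (f (Fin.castLE hk a)), fun a b hab => ?_, fun a => ?_⟩
  · simpa using hab
  · rw [hf, List.get_ofFn]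

/-! ### Two-dimensional Reed-Solomon codes -/

/-- If two nonconstant affine functions agree along two increasing triples of positions `i` and `j`,
then consecutive differences of evaluation points along `i` and along `j` are in the same ratio. When
this ratio determines the first two positions, the affine functions agree at two points. -/
theorem correctsInsDel_rsCode_two {F : Type*} [Field F] {n : ℕ} (hn : 3 ≤ n) {α : Fin n → F}
    (hα : Function.Injective α)
    (h : ∀ i j : Fin 3 → Fin n, StrictMono i → StrictMono j →
      (α (i 0) - α (i 1)) * (α (j 1) - α (j 2)) = (α (i 1) - α (i 2)) * (α (j 0) - α (j 1)) →
      i 0 = j 0 ∧ i 1 = j 1) :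
    CorrectsInsDel (rsCode α 2) (n - 3) := by
  refine correctsInsDel_of_common_sublist ?_
  rintro _ ⟨f, hf, rfl⟩ _ ⟨f', hf', rfl⟩ z hz hz' hlen
  obtain ⟨i, hi, hiz⟩ := hz.exists_strictMono_ofFn (k := 3) (by omega)
  obtain ⟨j, hj, hjz⟩ := hz'.exists_strictMono_ofFn (k := 3) (by omega)
  have heq : ∀ a, f.eval (α (i a)) = f'.eval (α (j a)) := fun a => (hiz a).trans (hjz a).symm
  obtain ⟨a, b, rfl⟩ := exists_eq_X_add_C_of_natDegree_le_one
    (natDegree_le_of_degree_le (Order.le_of_lt_succ (b := 1) hf))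
  obtain ⟨a', b', rfl⟩ := exists_eq_X_add_C_of_natDegree_le_one
    (natDegree_le_of_degree_le (Order.le_of_lt_succ (b := 1) hf'))
  simp only [eval_add, eval_mul, eval_C, eval_X] at heq ⊢
  have hne : ∀ {i : Fin 3 → Fin n}, StrictMono i → α (i 0) - α (i 1) ≠ 0 := fun hi =>
    sub_ne_zero.2 fun h => (hi (show (0 : Fin 3) < 1 by decide)).ne (hα h)
  have h01 : a * (α (i 0) - α (i 1)) = a' * (α (j 0) - α (j 1)) := by
    linear_combination heq 0 - heq 1
  have h12 : a * (α (i 1) - α (i 2)) = a' * (α (j 1) - α (j 2)) := by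
    linear_combination heq 1 - heq 2
  suffices haa : a = a' ∧ b = b' by rw [haa.1, haa.2]
  by_cases ha' : a' = 0
  · have ha : a = 0 := by simpa [ha', hne hi] using h01
    exact ⟨ha.trans ha'.symm, by simpa [ha, ha'] using heq 0⟩
  · obtain ⟨h0, h1⟩ := h i j hi hj <| mul_left_cancel₀ ha' <| by
      have ha : a ≠ 0 := by
        rintro rfl
        simp [ha', hne hj] at h01
      linear_combination (α (i 1) - α (i 2)) * h01 - (α (i 0) - α (i 1)) * h12
    rw [h0, h1] at h01
    have haa := mul_right_cancel₀ (hne hj) h01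
    refine ⟨haa, ?_⟩
    have := heq 0
    rw [haa, h0] at this
    exact add_left_cancel this

/-! ### Sidon spaces and parity-check matrices -/

section Construction

variable {F : Type*} [Field F] [Algebra (ZMod 3) F]

theorem eq_or_eq_neg_of_span_eq {a c : F} (ha : a ≠ 0)
    (h : Submodule.span (ZMod 3) {a} = Submodule.span (ZMod 3) {c}) : a = c ∨ a = -c := by
  have : a ∈ Submodule.span (ZMod 3) {c} := h ▸ Submodule.mem_span_singleton_self a
  obtain ⟨x, rfl⟩ := Submodule.mem_span_singleton.1 this
  have hx : x = 0 ∨ x = 1 ∨ x = -1 :=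
    (show ∀ x : ZMod 3, x = 0 ∨ x = 1 ∨ x = -1 by decide) x
  rcases hx with rfl | rfl | rfl <;> simp_all

theorem IsSidonSpace.eq_or_eq_neg {S : Submodule (ZMod 3) F} (hS : IsSidonSpace S) {a b c d : F}
    (ha : a ∈ S) (hb : b ∈ S) (hc : c ∈ S) (hd : d ∈ S) (ha0 : a ≠ 0) (hb0 : b ≠ 0) (hc0 : c ≠ 0)
    (hd0 : d ≠ 0) (h : a * b = c * d) : (a = c ∨ a = -c) ∨ (a = d ∨ a = -d) := by
  rcases Set.pair_eq_pair_iff.1 (hS a ha b hb c hc d hd ha0 hb0 hc0 hd0 h) with ⟨h, -⟩ | ⟨h, -⟩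
  · exact .inl (eq_or_eq_neg_of_span_eq ha0 h)
  · exact .inr (eq_or_eq_neg_of_span_eq ha0 h)

theorem evalPoints_mem {r N : ℕ} {S : Submodule (ZMod 3) F} {s : Fin r → F} (hs : IsBasisOf s S)
    (H : Matrix (Fin r) (Fin N) (ZMod 3)) (j : Fin N) : evalPoints s H j ∈ S := by
  rw [← hs.2]
  refine Submodule.sum_mem _ fun i _ => ?_
  rw [mul_comm, ← Algebra.smul_def]
  exact Submodule.smul_mem _ _ (Submodule.subset_span ⟨i, rfl⟩)

theorem sum_smul_evalPoints {r N : ℕ} (s : Fin r → F) (H : Matrix (Fin r) (Fin N) (ZMod 3))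
    (x : Fin N → ZMod 3) : ∑ j, x j • evalPoints s H j = ∑ i, H.mulVec x i • s i := by
  simp only [evalPoints, Matrix.mulVec, dotProduct, Finset.smul_sum, Finset.sum_smul]
  rw [Finset.sum_comm]
  refine Finset.sum_congr rfl fun i _ => Finset.sum_congr rfl fun j _ => ?_
  rw [Algebra.smul_def, Algebra.smul_def, map_mul]
  ring

/-- Minimum distance at least `5`: a linear relation between four evaluation points is trivial. -/
theorem IsGoodParityCheck.sum_single_eq_zero {m N : ℕ} {H : Matrix (Fin (2 * m)) (Fin N) (ZMod 3)}
    (hH : IsGoodParityCheck H) {s : Fin (2 * m) → F} (hs : LinearIndependent (ZMod 3) s)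
    (p : Fin 4 → Fin N) (c : Fin 4 → ZMod 3) (h : ∑ k, c k • evalPoints s H (p k) = 0) :
    ∑ k, Pi.single (M := fun _ => ZMod 3) (p k) (c k) = 0 := by
  set x : Fin N → ZMod 3 := ∑ k, Pi.single (p k) (c k) with hx
  have hsum : ∑ j, x j • evalPoints s H j = 0 := by
    rw [← h]
    simp only [hx, Finset.sum_apply, Finset.sum_smul]
    rw [Finset.sum_comm]
    simp [Pi.single_apply]
  rw [sum_smul_evalPoints] at hsum
  by_contra hx0
  have h5 := hH.2 x (funext (Fintype.linearIndependent_iff.1 hs _ hsum)) hx0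
  have h4 : hammingNorm x ≤ (Finset.univ.image p).card := by
    refine Finset.card_le_card fun j hj => ?_
    by_contra hjp
    refine (Finset.mem_filter.1 hj).2 ?_
    rw [hx, Finset.sum_apply]
    refine Finset.sum_eq_zero fun k _ => Pi.single_eq_of_ne ?_ _
    rintro rfl
    exact hjp (Finset.mem_image_of_mem _ (Finset.mem_univ k))
  have := Finset.card_image_le (s := Finset.univ) (f := p)
  simp only [Finset.card_univ, Fintype.card_fin] at this
  omega

variable {m N : ℕ} {H : Matrix (Fin (2 * m)) (Fin N) (ZMod 3)} {s : Fin (2 * m) → F}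

theorem IsGoodParityCheck.injective_evalPoints (hH : IsGoodParityCheck H)
    (hs : LinearIndependent (ZMod 3) s) : Function.Injective (evalPoints s H) := by
  intro a b hab
  have h := congrFun (hH.sum_single_eq_zero hs ![a, b, a, a] ![1, -1, 0, 0]
    (by simp [Fin.sum_univ_four, hab])) a
  by_contra hne
  simp [Fin.sum_univ_four, Pi.single_apply, hne] at h

/-- No three evaluation points sum to zero; in characteristic three this says that there is no
three-term arithmetic progression. -/
theorem IsGoodParityCheck.add_add_ne_zero (hH : IsGoodParityCheck H)
    (hs : LinearIndependent (ZMod 3) s) {a b c : Fin N} (hab : a ≠ b) (hac : a ≠ c) :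
    evalPoints s H a + evalPoints s H b + evalPoints s H c ≠ 0 := by
  intro h0
  have h := congrFun (hH.sum_single_eq_zero hs ![a, b, c, a] ![1, 1, 1, 0]
    (by simpa [Fin.sum_univ_four] using h0)) a
  simp [Fin.sum_univ_four, Pi.single_apply, hab, hac] at h

theorem IsGoodParityCheck.eq_of_sub_eq_sub (hH : IsGoodParityCheck H)
    (hs : LinearIndependent (ZMod 3) s) {a b c d : Fin N} (hab : a ≠ b)
    (h0 : evalPoints s H a - evalPoints s H b = evalPoints s H c - evalPoints s H d) :
    a = c ∧ b = d := by
  have h := hH.sum_single_eq_zero hs ![a, b, c, d] ![1, -1, -1, 1] (by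
    simp only [Fin.sum_univ_four, Matrix.cons_val, one_smul, neg_smul]
    linear_combination h0)
  have ha := congrFun h a
  have hb := congrFun h b
  simp only [Fin.sum_univ_four, Matrix.cons_val, Pi.add_apply, Pi.single_apply, Pi.zero_apply,
    if_true, if_neg hab, if_neg hab.symm] at ha hb
  have key : (1 + 1 : ZMod 3) ≠ 0 ∧ (-1 + -1 : ZMod 3) ≠ 0 ∧ (1 : ZMod 3) ≠ 0 ∧
      (-1 : ZMod 3) ≠ 0 := by decide
  constructor
  · by_contra hac
    rw [if_neg hac] at ha
    split_ifs at ha <;> simp_all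
  · by_contra hbd
    rw [if_neg hbd] at hb
    split_ifs at hb <;> simp_all

/-- The criterion of `correctsInsDel_rsCode_two` holds: by the Sidon property an equality of products of differences
of evaluation points is an equality of differences up to sign, and by the distance of the
code such an equality is trivial. -/
theorem IsSidonSpace.correctsInsDel {S : Submodule (ZMod 3) F} (hS : IsSidonSpace S)
    (hs : IsBasisOf s S) (hH : IsGoodParityCheck H) {n : ℕ} (hn : 3 ≤ n) (e : Fin n ↪ Fin N) :
    CorrectsInsDel (rsCode (evalPoints s H ∘ e) 2) (n - 3) := by
  have : CharP F 3 := charP_of_injective_algebraMap (algebraMap (ZMod 3) F).injective 3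
  have h3 : (3 : F) = 0 := by exact_mod_cast CharP.cast_eq_zero F 3
  have hinj := hH.injective_evalPoints hs.1
  refine correctsInsDel_rsCode_two hn (hinj.comp e.injective) fun i j hi hj hij => ?_
  have hmem : ∀ p q, evalPoints s H (e p) - evalPoints s H (e q) ∈ S := fun p q =>
    S.sub_mem (evalPoints_mem hs H _) (evalPoints_mem hs H _)
  have hne : ∀ {p q : Fin n}, p ≠ q → evalPoints s H (e p) - evalPoints s H (e q) ≠ 0 :=
    fun hpq => sub_ne_zero.2 fun h => hpq (e.injective (hinj h))
  have h01 : (0 : Fin 3) ≠ 1 := by decide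
  have h12 : (1 : Fin 3) ≠ 2 := by decide
  have h02 : (0 : Fin 3) ≠ 2 := by decide
  have hi01 := hi.injective.ne h01
  have hj01 := hj.injective.ne h01
  have hei01 := e.injective.ne hi01
  rcases hS.eq_or_eq_neg (hmem _ _) (hmem _ _) (hmem _ _) (hmem _ _) (hne hi01)
    (hne (hj.injective.ne h12)) (hne (hi.injective.ne h12)) (hne hj01) hij with (h | h) | (h | h)
  · refine absurd ?_ (hH.add_add_ne_zero hs.1 hei01 (e.injective.ne (hi.injective.ne h02)))
    linear_combination h + evalPoints s H (e (i 1)) * h3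
  · exact absurd (e.injective (hinj (by linear_combination h))) (hi.injective.ne h02)
  · obtain ⟨h0, h1⟩ := hH.eq_of_sub_eq_sub hs.1 hei01 h
    exact ⟨e.injective h0, e.injective h1⟩
  · rw [neg_sub] at h
    obtain ⟨h0, h1⟩ := hH.eq_of_sub_eq_sub hs.1 hei01 h
    -- Both triples are increasing, so a swap of the two indices is impossible.
    have hlt := hi (show (0 : Fin 3) < 1 by decide)
    rw [e.injective h0, e.injective h1] at hlt
    exact absurd hlt (hj (show (0 : Fin 3) < 1 by decide)).asymm

end Construction

/-! ### The Sidon spaces of Roth, Raviv and Tamo -/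

section FixedField

variable {F : Type*} [Field F] [Algebra (ZMod 3) F]

theorem charP_three_of_algebra (F : Type*) [Field F] [Algebra (ZMod 3) F] : CharP F 3 :=
  charP_of_injective_algebraMap (algebraMap (ZMod 3) F).injective 3

theorem expChar_three_of_algebra (F : Type*) [Field F] [Algebra (ZMod 3) F] : ExpChar F 3 :=
  have := charP_three_of_algebra F
  .prime Nat.prime_three

/-- The fixed field of the `k`-th power of the Frobenius; it is the subfield of order `3 ^ k`
when `1 ≤ k` and the ambient field contains one. -/
def frobFixedField (F : Type*) [Field F] [Algebra (ZMod 3) F] (k : ℕ) :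
    IntermediateField (ZMod 3) F where
  carrier := {u | u ^ 3 ^ k = u}
  mul_mem' {a b} ha hb := by
    simp only [Set.mem_ofPred_eq] at *
    rw [mul_pow, ha, hb]
  add_mem' {a b} ha hb := by
    have := expChar_three_of_algebra F
    simp only [Set.mem_ofPred_eq] at *
    rw [add_pow_expChar_pow, ha, hb]
  algebraMap_mem' a := by
    simp only [Set.mem_ofPred_eq]
    rw [← map_pow, ZMod.pow_card_pow]
  inv_mem' a ha := by
    simp only [Set.mem_ofPred_eq] at *
    rw [inv_pow, ha]

theorem mem_frobFixedField {k : ℕ} {u : F} : u ∈ frobFixedField F k ↔ u ^ 3 ^ k = u := Iff.rfl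

theorem finrank_frobFixedField [Finite F] {k : ℕ} (hk : 1 ≤ k) {ζ : F}
    (hζ : IsPrimitiveRoot ζ (3 ^ k - 1)) : Module.finrank (ZMod 3) (frobFixedField F k) = k := by
  classical
  have h3k : 3 ^ 1 ≤ 3 ^ k := Nat.pow_le_pow_right (by norm_num) hk
  have hset : (frobFixedField F k : Set F) = (insert 0 (nthRootsFinset (3 ^ k - 1) (1 : F)) :
      Finset F) := by
    ext u
    rw [SetLike.mem_coe, mem_frobFixedField, Finset.mem_coe, Finset.mem_insert,
      mem_nthRootsFinset (by omega)]
    rcases eq_or_ne u 0 with rfl | hu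
    · simp
    · conv_lhs => rw [show 3 ^ k = (3 ^ k - 1) + 1 by omega, pow_succ]
      simp [hu]
  have hcard : Nat.card (frobFixedField F k) = 3 ^ k := by
    rw [← SetLike.coe_sort_coe, hset, Nat.card_coe_set_eq, Set.ncard_coe_finset,
      Finset.card_insert_of_notMem, hζ.card_nthRootsFinset]
    · omega
    · rw [mem_nthRootsFinset (by omega), zero_pow (by omega)]
      exact zero_ne_one
  have := Module.natCard_eq_pow_finrank (K := ZMod 3) (V := frobFixedField F k)
  rw [hcard, Nat.card_zmod] at this
  exact (Nat.pow_right_injective (show 2 ≤ 3 by norm_num) this).symm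

/-- Elements of a field outside a subfield are independent of `1`. -/
theorem eq_and_eq_of_add_mul_eq_add_mul {E : IntermediateField (ZMod 3) F} {γ p q p' q' : F}
    (hγ : γ ∉ E) (hp : p ∈ E) (hq : q ∈ E) (hp' : p' ∈ E) (hq' : q' ∈ E)
    (h : p + q * γ = p' + q' * γ) : p = p' ∧ q = q' := by
  have hqq : q = q' := by
    by_contra hne
    refine hγ ?_
    rw [show γ = (p' - p) / (q - q') by
      rw [eq_div_iff (sub_ne_zero.2 hne)]
      linear_combination h]
    exact E.div_mem (E.sub_mem hp' hp) (E.sub_mem hq hq')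
  subst hqq
  exact ⟨add_right_cancel h, rfl⟩

/-- The parametrization `u ↦ u + u ^ 3 * γ` of `rrtSpace m γ` by the subfield of order
`3 ^ (2 * m)`. -/
def rrtMap (m : ℕ) (γ : F) : frobFixedField F (2 * m) →ₗ[ZMod 3] F where
  toFun u := (u : F) + (u : F) ^ 3 * γ
  map_add' u v := by
    have := expChar_three_of_algebra F
    push_cast
    rw [add_pow_expChar]
    ring
  map_smul' a u := by
    have h3 : a ^ 3 = a := ZMod.pow_card a
    simp only [IntermediateField.coe_smul, RingHom.id_apply, _root_.smul_pow, h3, smul_add,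
      smul_mul_assoc]

theorem range_rrtMap (m : ℕ) (γ : F) : LinearMap.range (rrtMap m γ) = rrtSpace m γ := by
  ext x
  constructor
  · rintro ⟨u, rfl⟩
    exact ⟨u, u.2, rfl⟩
  · rintro ⟨u, hu, rfl⟩
    exact ⟨⟨u, hu⟩, rfl⟩

theorem rrtMap_injective {m : ℕ} {γ : F} (hγ : γ ∉ frobFixedField F (2 * m)) :
    Function.Injective (rrtMap m γ) := fun u v h =>
  Subtype.ext (eq_and_eq_of_add_mul_eq_add_mul hγ u.2 (pow_mem u.2 3) v.2 (pow_mem v.2 3) h).1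

/-- Reducing by `γ ^ 2 = -b * γ - c` and comparing coordinates, an equality of two products
`(u + u ^ 3 * γ) * (v + v ^ 3 * γ)` determines `u * v - c * (u * v) ^ 3`, hence `u * v` because `c`
is not a square, and then `u ^ 2 + v ^ 2`. -/
theorem IsRRTElement.isSidonSpace {m : ℕ} {γ : F} (hγ : IsRRTElement m γ) :
    IsSidonSpace (rrtSpace m γ) := by
  have := expChar_three_of_algebra F
  obtain ⟨hγE, b, c, hb, hc, hroot, hsq⟩ := hγ
  set E := frobFixedField F (2 * m)
  have hEmem : ∀ {u : F}, u ^ 3 ^ (2 * m) = u → u ∈ E := fun h => h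
  rintro x hx y hy x' hx' y' hy' hx0 hy0 hx0' hy0' hxy
  -- It suffices that `x` agrees with one factor on the right up to sign.
  have key : (x = x' ∨ x = -x') ∨ (x = y' ∨ x = -y') := by
    obtain ⟨u, hu, rfl⟩ := hx
    obtain ⟨v, hv, rfl⟩ := hy
    obtain ⟨u', hu', rfl⟩ := hx'
    obtain ⟨v', hv', rfl⟩ := hy'
    have hu0 : u ≠ 0 := by rintro rfl; simp at hx0
    have hv0 : v ≠ 0 := by rintro rfl; simp at hy0
    replace hu := hEmem hu
    replace hv := hEmem hv
    replace hu' := hEmem hu'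
    replace hv' := hEmem hv'
    replace hb := hEmem hb
    replace hc := hEmem hc
    have hcoord : ∀ {u v : F}, u ∈ E → v ∈ E → u * v - c * (u * v) ^ 3 ∈ E ∧
        u * v ^ 3 + u ^ 3 * v - b * (u * v) ^ 3 ∈ E := fun hu hv =>
      ⟨E.sub_mem (E.mul_mem hu hv) (E.mul_mem hc (pow_mem (E.mul_mem hu hv) 3)),
        E.sub_mem (E.add_mem (E.mul_mem hu (pow_mem hv 3)) (E.mul_mem (pow_mem hu 3) hv))
          (E.mul_mem hb (pow_mem (E.mul_mem hu hv) 3))⟩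
    obtain ⟨h1, h2⟩ := eq_and_eq_of_add_mul_eq_add_mul hγE (hcoord hu hv).1 (hcoord hu hv).2
      (hcoord hu' hv').1 (hcoord hu' hv').2 (by
        linear_combination hxy - ((u * v) ^ 3 - (u' * v') ^ 3) * hroot)
    have hP : u * v = u' * v' := by
      by_contra hne
      have hD := sub_ne_zero.2 hne
      have hcube : (u * v - u' * v') ^ 3 = (u * v) ^ 3 - (u' * v') ^ 3 := sub_pow_expChar ..
      refine hsq (u * v - u' * v')⁻¹
        (E.inv_mem (E.sub_mem (E.mul_mem hu hv) (E.mul_mem hu' hv'))) ?_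
      have hcD : c * (u * v - u' * v') ^ 2 = 1 := by
        refine mul_right_cancel₀ hD ?_
        linear_combination c * hcube - h1
      rw [inv_pow]
      exact (eq_inv_of_mul_eq_one_left hcD).symm
    have hQ : u ^ 2 + v ^ 2 = u' ^ 2 + v' ^ 2 := by
      refine mul_left_cancel₀ (mul_ne_zero hu0 hv0) ?_
      rw [hP] at h2
      linear_combination h2 - (u' ^ 2 + v' ^ 2) * hP
    have hroots : (u ^ 2 - u' ^ 2) * (u ^ 2 - v' ^ 2) = 0 := by
      linear_combination u ^ 2 * hQ - (u * v + u' * v') * hP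
    rcases mul_eq_zero.1 hroots with h | h
    · rcases sq_eq_sq_iff_eq_or_eq_neg.1 (sub_eq_zero.1 h) with rfl | rfl
      · exact .inl (.inl rfl)
      · exact .inl (.inr (by ring))
    · rcases sq_eq_sq_iff_eq_or_eq_neg.1 (sub_eq_zero.1 h) with rfl | rfl
      · exact .inr (.inl rfl)
      · exact .inr (.inr (by ring))
  have hneg : ∀ z : F, Submodule.span (ZMod 3) {-z} = Submodule.span (ZMod 3) {z} := fun z => by
    rw [← Set.neg_singleton, Submodule.span_neg]
  rw [Set.pair_eq_pair_iff]
  rcases key with (rfl | rfl) | (rfl | rfl)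
  · obtain rfl : y = y' := mul_left_cancel₀ hx0 hxy
    exact .inl ⟨rfl, rfl⟩
  · obtain rfl : y = -y' := mul_left_cancel₀ hx0 (by rw [hxy]; ring)
    exact .inl ⟨hneg _, hneg _⟩
  · obtain rfl : y = x' := mul_left_cancel₀ hx0 (by rw [hxy]; ring)
    exact .inr ⟨rfl, rfl⟩
  · obtain rfl : y = -x' := mul_left_cancel₀ hx0 (by rw [hxy]; ring)
    exact .inr ⟨hneg _, hneg _⟩

theorem exists_isPrimitiveRoot_natCard_sub_one (F : Type*) [Field F] [Finite F] :
    ∃ g : F, IsPrimitiveRoot g (Nat.card F - 1) := by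
  obtain ⟨g, hg⟩ := IsCyclic.exists_ofOrder_eq_natCard (α := Fˣ)
  refine ⟨g, ?_⟩
  rw [IsPrimitiveRoot.coe_units_iff, ← Nat.card_units, ← hg]
  exact IsPrimitiveRoot.orderOf g

theorem three_pow_four_mul_sub_one (m : ℕ) :
    3 ^ (4 * m) - 1 = (3 ^ (2 * m) + 1) * (3 ^ (2 * m) - 1) := by
  rw [show 4 * m = 2 * m * 2 by ring, pow_mul, ← one_pow 2, Nat.sq_sub_sq, one_pow]

theorem three_pow_four_mul_sub_one_pos {m : ℕ} (hm : 1 ≤ m) : 0 < 3 ^ (4 * m) - 1 :=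
  Nat.sub_pos_of_lt (Nat.one_lt_pow (by omega) (by norm_num))

theorem IsPrimitiveRoot.finrank_frobFixedField {m : ℕ} (hm : 1 ≤ m) [Finite F] {g : F}
    (hg : IsPrimitiveRoot g (3 ^ (4 * m) - 1)) :
    Module.finrank (ZMod 3) (frobFixedField F (2 * m)) = 2 * m :=
  _root_.finrank_frobFixedField (by omega)
    (hg.pow (three_pow_four_mul_sub_one_pos hm) (three_pow_four_mul_sub_one m))

theorem IsRRTElement.finrank_rrtSpace {m : ℕ} {γ : F} (hγ : IsRRTElement m γ)
    (hE : Module.finrank (ZMod 3) (frobFixedField F (2 * m)) = 2 * m) :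
    Module.finrank (ZMod 3) (rrtSpace m γ) = 2 * m := by
  rw [← range_rrtMap, LinearMap.finrank_range_of_inj (rrtMap_injective hγ.1), hE]

/-- A primitive element `g` is a root of `X ^ 2 - (g + g ^ Q) X + g ^ (Q + 1)`, where
`Q = 3 ^ (2 * m)`, and its norm `g ^ (Q + 1)` generates the multiplicative group of the subfield
of order `Q`. -/
theorem IsPrimitiveRoot.isRRTElement {m : ℕ} (hm : 1 ≤ m) {g : F}
    (hg : IsPrimitiveRoot g (3 ^ (4 * m) - 1)) : IsRRTElement m g := by
  have := expChar_three_of_algebra F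
  have hfac := three_pow_four_mul_sub_one m
  have hQ : 3 ^ 1 < 3 ^ (2 * m) := Nat.pow_lt_pow_right (by norm_num) (by omega)
  have hodd : 2 ∣ 3 ^ (2 * m) - 1 := by
    simpa using Nat.sub_dvd_pow_sub_pow 3 1 (2 * m)
  set Q := 3 ^ (2 * m) with hQdef
  have hpos := three_pow_four_mul_sub_one_pos hm
  rw [hfac] at hg hpos
  have hg0 : g ≠ 0 := hg.ne_zero hpos.ne'
  have hgQ : (g ^ Q) ^ Q = g := by
    have h1 := hg.pow_eq_one
    rw [← pow_mul]
    calc g ^ (Q * Q) = g ^ ((Q + 1) * (Q - 1) + 1) := by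
          congr 1
          zify [show 1 ≤ Q by omega]
          ring
      _ = g := by rw [pow_succ, h1, one_mul]
  refine ⟨fun h => ?_, -(g + g ^ Q), g * g ^ Q, ?_, ?_, by ring, fun y hy hyc => ?_⟩
  · have h1 : g ^ (Q - 1) = 1 := by
      refine mul_right_cancel₀ hg0 ?_
      rw [← pow_succ, Nat.sub_add_cancel (by omega), h, one_mul]
    have := Nat.le_of_dvd (by omega) ((hg.pow_eq_one_iff_dvd _).1 h1)
    nlinarith [Nat.sub_pos_of_lt (show 1 < Q by omega)]
  · rw [Odd.neg_pow (Odd.pow (by decide)), hQdef, add_pow_expChar_pow, ← hQdef, hgQ, add_comm]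
  · rw [mul_pow, hgQ, mul_comm]
  · have hy0 : y ≠ 0 := by
      rintro rfl
      simp [hg0] at hyc
    have h1 : y ^ (Q - 1) = 1 := by
      refine mul_right_cancel₀ hy0 ?_
      rw [← pow_succ, Nat.sub_add_cancel (by omega), hy, one_mul]
    obtain ⟨d, hd⟩ := hodd
    rw [hd, pow_mul, hyc, ← pow_succ', ← pow_mul, hg.pow_eq_one_iff_dvd, hd] at h1
    have := Nat.le_of_dvd (Nat.mul_pos (by omega) (by omega)) h1
    nlinarith [show 0 < d by omega]

end FixedField

/-! ### The negacyclic code of `β` -/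

/-- The Vandermonde argument behind the BCH bound: a nonzero vector orthogonal to the first `d` powers
of distinct nodes has more than `d` nonzero entries. -/
theorem lt_card_support_of_sum_mul_pow_eq_zero {F ι : Type*} [Field F] [Fintype ι] [DecidableEq ι]
    [DecidableEq F] {d : ℕ} {y z : ι → F} (hz : Function.Injective z)
    (h : ∀ t < d, ∑ j, y j * z j ^ t = 0) (hy : y ≠ 0) :
    d < (Finset.univ.filter fun j => y j ≠ 0).card := by
  set T := Finset.univ.filter fun j => y j ≠ 0 with hT
  by_contra! hcard
  obtain ⟨j₀, hj₀⟩ := Function.ne_iff.1 hy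
  have hj₀T : j₀ ∈ T := by simpa [hT] using hj₀
  set p : F[X] := ∏ j ∈ T.erase j₀, (X - C (z j)) with hp
  have hdeg : p.natDegree < d := by
    rw [hp, natDegree_finsetProd_X_sub_C_eq_card, Finset.card_erase_of_mem hj₀T]
    have := Finset.card_pos.2 ⟨j₀, hj₀T⟩
    omega
  have hsum : ∑ j, y j * p.eval (z j) = 0 := by
    simp only [eval_eq_sum_range' hdeg, Finset.mul_sum]
    rw [Finset.sum_comm]
    refine Finset.sum_eq_zero fun t ht => ?_
    rw [← mul_zero (p.coeff t), ← h t (Finset.mem_range.1 ht), Finset.mul_sum]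
    exact Finset.sum_congr rfl fun j _ => by ring
  rw [Finset.sum_eq_single j₀] at hsum
  · rcases mul_eq_zero.1 hsum with h0 | h0
    · exact hj₀ h0
    · rw [hp, eval_prod, Finset.prod_eq_zero_iff] at h0
      obtain ⟨j, hj, hj0⟩ := h0
      rw [eval_sub, eval_X, eval_C, sub_eq_zero] at hj0
      exact Finset.ne_of_mem_erase hj (hz hj0).symm
  · intro j _ hj
    by_cases hjT : j ∈ T
    · rw [hp, eval_prod, Finset.prod_eq_zero (Finset.mem_erase.2 ⟨hj, hjT⟩) (by simp), mul_zero]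
    · rw [show y j = 0 by simpa [hT] using hjT, zero_mul]
  · simp

section Negacyclic

variable {F : Type*} [Field F] [Algebra (ZMod 3) F] {m : ℕ} {β : F}

theorem three_pow_succ_eq_two_mul (m : ℕ) : 3 ^ m + 1 = 2 * ((3 ^ m + 1) / 2) := by
  have : Odd (3 ^ m) := Odd.pow (by decide)
  have := this.add_one.two_dvd
  omega

theorem four_mul_le_three_pow_succ (hm : 1 ≤ m) : 4 * m ≤ 3 ^ m + 1 := by
  induction m, hm using Nat.le_induction with
  | base => norm_num
  | succ k hk ih => rw [pow_succ]; omega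

/-- The order of `3` modulo `3 ^ m + 1` is at least `2 * m`. -/
theorem not_three_pow_succ_dvd {k : ℕ} (hk0 : 0 < k) (hk : k < 2 * m) :
    ¬ 3 ^ m + 1 ∣ 3 ^ k - 1 := by
  intro h
  rcases le_or_gt k m with hkm | hkm
  · have h1 : 3 ^ k ≤ 3 ^ m := Nat.pow_le_pow_right (by norm_num) hkm
    have h2 : 1 < 3 ^ k := Nat.one_lt_pow hk0.ne' (by norm_num)
    have := Nat.le_of_dvd (by omega) h
    omega
  · obtain ⟨r, rfl⟩ := Nat.exists_eq_add_of_lt hkm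
    -- With `k = m + k'`, `3 ^ k - 1 = 3 ^ k' * (3 ^ m + 1) - (3 ^ k' + 1)`; here `k' = r + 1`.
    have h1 : 3 ^ (r + 1) < 3 ^ m := Nat.pow_lt_pow_right (by norm_num) (by omega)
    have h2 : 3 ^ m + 1 ∣ 3 ^ (r + 1) * (3 ^ m + 1) - (3 ^ (m + r + 1) - 1) :=
      Nat.dvd_sub (Dvd.intro_left _ rfl) h
    have h3 : 3 ^ (r + 1) * (3 ^ m + 1) - (3 ^ (m + r + 1) - 1) = 3 ^ (r + 1) + 1 := by
      have h4 : 3 ^ (r + 1) * (3 ^ m + 1) = 3 ^ (m + r + 1) + 3 ^ (r + 1) := by ring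
      have h5 : 0 < 3 ^ (m + r + 1) := by positivity
      rw [h4]
      generalize 3 ^ (m + r + 1) = x at h5 ⊢
      generalize 3 ^ (r + 1) = y
      omega
    rw [h3] at h2
    have := Nat.le_of_dvd (Nat.succ_pos _) h2
    omega

theorem IsPrimitiveRoot.injective_conjugates (hβ : IsPrimitiveRoot β (3 ^ m + 1)) :
    Function.Injective fun i : Fin (2 * m) => β ^ 3 ^ (i : ℕ) := by
  have := expChar_three_of_algebra F
  have hβ0 : β ≠ 0 := hβ.ne_zero (Nat.succ_ne_zero _)
  have key : ∀ i k : ℕ, i + k < 2 * m → 0 < k → β ^ 3 ^ i ≠ β ^ 3 ^ (i + k) := by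
    intro i k hik hk h
    rw [pow_add, mul_comm, pow_mul] at h
    have h1 : β = β ^ 3 ^ k := iterateFrobenius_inj F 3 i h
    refine not_three_pow_succ_dvd hk (by omega) ((hβ.pow_eq_one_iff_dvd _).1 ?_)
    refine mul_right_cancel₀ hβ0 ?_
    rw [← pow_succ, Nat.sub_add_cancel (Nat.one_le_pow k 3 (by norm_num)), ← h1, one_mul]
  intro i j hij
  by_contra hne
  rcases lt_or_gt_of_ne hne with h | h
  · exact key i (j - i) (by omega) (by omega) (by
      rw [Nat.add_sub_cancel' (by exact_mod_cast h.le)]; exact hij)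
  · exact key j (i - j) (by omega) (by omega) (by
      rw [Nat.add_sub_cancel' (by exact_mod_cast h.le)]; exact hij.symm)

theorem aeval_pow_three_pow_eq_zero {p : (ZMod 3)[X]} {x : F} (h : aeval x p = 0) (k : ℕ) :
    aeval (x ^ 3 ^ k) p = 0 := by
  induction k with
  | zero => simpa using h
  | succ k ih => rw [pow_succ, pow_mul, ← expand_aeval, ZMod.expand_card, map_pow, ih, zero_pow
      three_ne_zero]

theorem IsPrimitiveRoot.mem_frobFixedField (hβ : IsPrimitiveRoot β (3 ^ m + 1)) :
    β ∈ frobFixedField F (2 * m) := by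
  have h : 3 ^ (2 * m) = (3 ^ m + 1) * (3 ^ m - 1) + 1 := by
    zify [Nat.one_le_pow m 3 (by norm_num)]
    ring
  rw [_root_.mem_frobFixedField, h, pow_succ, pow_mul, hβ.pow_eq_one, one_pow, one_mul]

/-- The minimal polynomial vanishes at the `2 * m` conjugates `β ^ 3 ^ i`, and `β` lies in the field
of degree `2 * m`. -/
theorem IsPrimitiveRoot.natDegree_minpoly [Finite F] (hβ : IsPrimitiveRoot β (3 ^ m + 1))
    (hE : Module.finrank (ZMod 3) (frobFixedField F (2 * m)) = 2 * m) :
    (minpoly (ZMod 3) β).natDegree = 2 * m := by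
  have hint : IsIntegral (ZMod 3) β := .of_finite _ β
  refine le_antisymm ?_ ?_
  · have hli := linearIndependent_pow (K := ZMod 3)
      (⟨β, hβ.mem_frobFixedField⟩ : frobFixedField F (2 * m))
    have := hli.fintype_card_le_finrank
    rwa [Fintype.card_fin, hE, ← minpoly.algebraMap_eq
      (algebraMap (frobFixedField F (2 * m)) F).injective] at this
  · by_contra! hlt
    refine (minpoly.monic hint).map (algebraMap (ZMod 3) F) |>.ne_zero ?_
    refine eq_zero_of_natDegree_lt_card_of_eval_eq_zero _ hβ.injective_conjugates (fun i => ?_) ?_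
    · rw [eval_map_algebraMap]
      exact aeval_pow_three_pow_eq_zero (minpoly.aeval _ _) _
    · rwa [natDegree_map, Fintype.card_fin]

theorem IsPrimitiveRoot.linearIndependent_powers [Finite F] (hβ : IsPrimitiveRoot β (3 ^ m + 1))
    (hE : Module.finrank (ZMod 3) (frobFixedField F (2 * m)) = 2 * m) :
    LinearIndependent (ZMod 3) fun i : Fin (2 * m) => β ^ (i : ℕ) := by
  have := linearIndependent_pow (K := ZMod 3) β
  rwa [hβ.natDegree_minpoly hE] at this

theorem IsPrimitiveRoot.sum_modByMonic_coeff_smul [Finite F] (hβ : IsPrimitiveRoot β (3 ^ m + 1))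
    (hE : Module.finrank (ZMod 3) (frobFixedField F (2 * m)) = 2 * m) (hm : 1 ≤ m) (j : ℕ) :
    ∑ i : Fin (2 * m), ((X : (ZMod 3)[X]) ^ j %ₘ minpoly (ZMod 3) β).coeff i • β ^ (i : ℕ) =
      β ^ j := by
  have hdeg := hβ.natDegree_minpoly hE
  have hmon := minpoly.monic (IsIntegral.of_finite (ZMod 3) β)
  rw [Fin.sum_univ_eq_sum_range
    (fun i => ((X : (ZMod 3)[X]) ^ j %ₘ minpoly (ZMod 3) β).coeff i • β ^ i),
    ← aeval_eq_sum_range', minpoly.aeval_modByMonic_minpoly, map_pow, aeval_X]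
  rw [← hdeg]
  refine natDegree_modByMonic_lt _ hmon fun h1 => ?_
  rw [h1, natDegree_one] at hdeg
  omega

/-- BCH bound: `β`, `β ^ 3`, `β⁻¹ = β ^ 3 ^ m` and `β⁻³` are conjugate, so a word orthogonal to the
powers of `β` is orthogonal to those of `β ^ t` for the four consecutive odd numbers
`t = -3, -1, 1, 3`. The nodes `β ^ (2 * j)` are distinct, since `β ^ 2` has order
`(3 ^ m + 1) / 2`. -/
theorem IsPrimitiveRoot.five_le_hammingNorm (hβ : IsPrimitiveRoot β (3 ^ m + 1))
    {x : Fin ((3 ^ m + 1) / 2) → ZMod 3} (hx : ∑ j, x j • β ^ (j : ℕ) = 0) (hx0 : x ≠ 0) :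
    5 ≤ hammingNorm x := by
  classical
  have := expChar_three_of_algebra F
  set a := algebraMap (ZMod 3) F
  have ha : Function.Injective a := (algebraMap (ZMod 3) F).injective
  have hconj : ∀ k, ∑ j, a (x j) * (β ^ (j : ℕ)) ^ 3 ^ k = 0 := fun k => by
    rw [← zero_pow (M₀ := F) (pow_ne_zero k three_ne_zero), ← hx, sum_pow_char_pow]
    refine Finset.sum_congr rfl fun j _ => ?_
    rw [Algebra.smul_def, mul_pow, ← map_pow, ZMod.pow_card_pow]
  have hinv : ∀ j : ℕ, (β ^ j) ^ 3 ^ m * β ^ j = 1 := fun j => by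
    rw [← pow_succ, ← pow_mul, mul_comm, pow_mul, hβ.pow_eq_one, one_pow]
  have hβ2 : IsPrimitiveRoot (β ^ 2) ((3 ^ m + 1) / 2) :=
    hβ.pow (Nat.succ_pos _) (three_pow_succ_eq_two_mul m)
  have key := lt_card_support_of_sum_mul_pow_eq_zero (d := 4)
    (y := fun j : Fin ((3 ^ m + 1) / 2) => a (x j) * (β ^ (j : ℕ)) ^ 3 ^ (m + 1))
    (z := fun j => (β ^ 2) ^ (j : ℕ))
    (fun i j hij => Fin.ext (hβ2.pow_inj i.2 j.2 hij)) ?_ ?_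
  · refine key.trans_le (Finset.card_le_card fun j hj => ?_)
    simp only [Finset.mem_filter, Finset.mem_univ, true_and] at hj ⊢
    rintro h0
    simp [h0] at hj
  · intro t ht
    -- With `u = β ^ j` and `w = u⁻¹`, the summands are `w ^ 3`, `w`, `u` and `u ^ 3`.
    have hexp : ∃ k, ∀ j : ℕ, (β ^ j) ^ 3 ^ (m + 1) * ((β ^ 2) ^ j) ^ t = (β ^ j) ^ 3 ^ k := by
      interval_cases t
      · exact ⟨m + 1, fun j => by ring⟩
      · refine ⟨m, fun j => ?_⟩
        rw [pow_succ 3 m, pow_mul _ (3 ^ m), pow_right_comm β 2]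
        linear_combination ((β ^ j) ^ 3 ^ m) * ((β ^ j) ^ 3 ^ m * β ^ j + 1) * hinv j
      · refine ⟨0, fun j => ?_⟩
        rw [pow_succ 3 m, pow_mul _ (3 ^ m), pow_right_comm β 2]
        linear_combination β ^ j * (((β ^ j) ^ 3 ^ m * β ^ j) ^ 2 + (β ^ j) ^ 3 ^ m * β ^ j + 1)
          * hinv j
      · refine ⟨1, fun j => ?_⟩
        rw [pow_succ 3 m, pow_mul _ (3 ^ m), pow_right_comm β 2]
        linear_combination (β ^ j) ^ 3 *
          (((β ^ j) ^ 3 ^ m * β ^ j) ^ 2 + (β ^ j) ^ 3 ^ m * β ^ j + 1) * hinv j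
    obtain ⟨k, hk⟩ := hexp
    simp only [mul_assoc, hk, hconj]
  · obtain ⟨j, hj⟩ := Function.ne_iff.1 hx0
    refine Function.ne_iff.2 ⟨j, mul_ne_zero ?_ (pow_ne_zero _ (pow_ne_zero _
      (hβ.ne_zero (Nat.succ_ne_zero _))))⟩
    rwa [← map_zero a, ha.ne_iff]

/-- The matrix of coordinates of `β ^ j` in the basis `β ^ i` is a good parity-check matrix. -/
theorem IsPrimitiveRoot.isGoodParityCheck [Finite F] (hβ : IsPrimitiveRoot β (3 ^ m + 1))
    (hm : 1 ≤ m) (hE : Module.finrank (ZMod 3) (frobFixedField F (2 * m)) = 2 * m)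
    {H : Matrix (Fin (2 * m)) (Fin ((3 ^ m + 1) / 2)) (ZMod 3)}
    (hH : ∀ j, ∑ i, H i j • β ^ (i : ℕ) = β ^ (j : ℕ)) : IsGoodParityCheck H := by
  have hli := Fintype.linearIndependent_iff.1 (hβ.linearIndependent_powers hE)
  have hmul : ∀ x, ∑ i, H.mulVec x i • β ^ (i : ℕ) = ∑ j, x j • β ^ (j : ℕ) := fun x => by
    simp only [Matrix.mulVec, dotProduct, Finset.sum_smul, ← hH, Finset.smul_sum, smul_smul]
    rw [Finset.sum_comm]
    simp only [mul_comm]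
  have hle : 2 * m ≤ (3 ^ m + 1) / 2 := by
    have := four_mul_le_three_pow_succ hm
    omega
  refine ⟨?_, fun x hx hx0 => hβ.five_le_hammingNorm (by simp [← hmul, hx]) hx0⟩
  -- The first `2 * m` columns form the identity matrix.
  have hsurj : LinearMap.range H.mulVecLin = ⊤ := by
    refine LinearMap.range_eq_top.2 fun y => ⟨∑ i, Pi.single (Fin.castLE hle i) (y i), ?_⟩
    refine funext fun i => sub_eq_zero.1 (hli (fun i => _ - y i) ?_ i)
    simp only [sub_smul, Finset.sum_sub_distrib, Matrix.mulVecLin_apply, hmul, Finset.sum_apply,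
      Finset.sum_smul]
    rw [Finset.sum_comm]
    simp [Pi.single_apply]
  have := H.mulVecLin.finrank_range_add_finrank_ker
  rw [hsurj, finrank_top, Module.finrank_fin_fun, Module.finrank_fin_fun] at this
  omega

end Negacyclic

/-! ### The explicit family -/

theorem IsPrimitiveRoot.betaElt {F : Type*} [Field F] {m : ℕ} {g : F} (hm : 1 ≤ m)
    (hg : IsPrimitiveRoot g (3 ^ (4 * m) - 1)) :
    IsPrimitiveRoot (betaElt m g) (3 ^ m + 1) := by
  refine hg.pow (three_pow_four_mul_sub_one_pos hm) ?_
  rw [three_pow_four_mul_sub_one]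
  zify [Nat.one_le_pow m 3 (by norm_num), Nat.one_le_pow (2 * m) 3 (by norm_num)]
  ring

section Explicit

variable {F : Type*} [Field F] [Algebra (ZMod 3) F] {m : ℕ} {g : F}

theorem isBasisOf_explicitBasis [Finite F] (hm : 1 ≤ m)
    (hg : IsPrimitiveRoot g (3 ^ (4 * m) - 1)) :
    IsBasisOf (explicitBasis m g) (rrtSpace m g) := by
  have hβ := hg.betaElt hm
  have hE := hg.finrank_frobFixedField hm
  have hγ := hg.isRRTElement hm
  have hmem : ∀ i : Fin (2 * m), betaElt m g ^ (i : ℕ) ∈ frobFixedField F (2 * m) :=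
    fun i => pow_mem hβ.mem_frobFixedField _
  have hli : LinearIndependent (ZMod 3) (explicitBasis m g) := by
    have h : LinearIndependent (ZMod 3)
        fun i : Fin (2 * m) => (⟨_, hmem i⟩ : frobFixedField F (2 * m)) :=
      .of_comp (frobFixedField F (2 * m)).val.toLinearMap (hβ.linearIndependent_powers hE)
    exact h.map' (rrtMap m g) (LinearMap.ker_eq_bot.2 (rrtMap_injective hγ.1))
  refine ⟨hli, Submodule.eq_of_le_of_finrank_eq ?_ ?_⟩
  · rw [Submodule.span_le]
    rintro _ ⟨i, rfl⟩
    exact ⟨_, hmem i, rfl⟩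
  · rw [finrank_span_eq_card hli, hγ.finrank_rrtSpace hE, Fintype.card_fin]

theorem sum_explicitMatrix_smul [Finite F] (hm : 1 ≤ m)
    (hg : IsPrimitiveRoot g (3 ^ (4 * m) - 1)) (j : Fin ((3 ^ m + 1) / 2)) :
    ∑ i, explicitMatrix m g i j • betaElt m g ^ (i : ℕ) = betaElt m g ^ (j : ℕ) :=
  (hg.betaElt hm).sum_modByMonic_coeff_smul (hg.finrank_frobFixedField hm) hm j

theorem isGoodParityCheck_explicitMatrix [Finite F] (hm : 1 ≤ m)
    (hg : IsPrimitiveRoot g (3 ^ (4 * m) - 1)) : IsGoodParityCheck (explicitMatrix m g) :=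
  (hg.betaElt hm).isGoodParityCheck hm (hg.finrank_frobFixedField hm)
    (sum_explicitMatrix_smul hm hg)

theorem evalPoints_explicit [Finite F] (hm : 1 ≤ m) (hg : IsPrimitiveRoot g (3 ^ (4 * m) - 1))
    (j : Fin ((3 ^ m + 1) / 2)) :
    evalPoints (explicitBasis m g) (explicitMatrix m g) j =
      betaElt m g ^ (j : ℕ) + betaElt m g ^ (3 * (j : ℕ)) * g := by
  have := expChar_three_of_algebra F
  have h := sum_explicitMatrix_smul hm hg j
  have h3 : ∑ i, explicitMatrix m g i j • (betaElt m g ^ (i : ℕ)) ^ 3 =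
      betaElt m g ^ (3 * (j : ℕ)) := by
    rw [mul_comm 3 (j : ℕ), pow_mul, ← h, sum_pow_char]
    refine Finset.sum_congr rfl fun i _ => ?_
    rw [_root_.smul_pow, show explicitMatrix m g i j ^ 3 = _ from ZMod.pow_card _]
  rw [← h3, Finset.sum_mul, ← h, ← Finset.sum_add_distrib]
  refine Finset.sum_congr rfl fun i _ => ?_
  rw [explicitBasis, mul_comm, ← Algebra.smul_def, smul_add, smul_mul_assoc]

end Explicit

/-! ### Codes of every length -/

/-- The least length parameter for `n` satisfies `3 ^ (m - 1) + 1 < 2 * n`, and so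
`3 ^ m ≤ 6 * n`. -/
theorem exists_isLeast_length {n : ℕ} (hn : 4 ≤ n) :
    ∃ m : ℕ, IsLeast {m : ℕ | n ≤ (3 ^ m + 1) / 2} m ∧ 2 ≤ m ∧ 3 ^ (4 * m) ≤ 6 ^ 4 * n ^ 4 := by
  classical
  have hex : ∃ m : ℕ, n ≤ (3 ^ m + 1) / 2 := by
    refine ⟨2 * n, ?_⟩
    have : 2 * n < 3 ^ (2 * n) := Nat.lt_pow_self (by norm_num)
    omega
  have hspec := Nat.find_spec hex
  have hmin : ∀ k, n ≤ (3 ^ k + 1) / 2 → Nat.find hex ≤ k := fun k hk => Nat.find_min' hex hk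
  generalize Nat.find hex = m at hspec hmin
  have hm2 : 2 ≤ m := by
    by_contra! hlt
    have : 3 ^ m ≤ 3 ^ 1 := Nat.pow_le_pow_right (by norm_num) (by omega)
    omega
  refine ⟨m, ⟨hspec, hmin⟩, hm2, ?_⟩
  have hprev : 3 ^ m ≤ 6 * n := by
    obtain ⟨k, rfl⟩ := Nat.exists_eq_add_of_le' (show 1 ≤ m by omega)
    have := mt (hmin k) (by omega)
    rw [pow_succ]
    omega
  rw [mul_comm, pow_mul, ← mul_pow]
  exact Nat.pow_le_pow_left hprev 4

theorem theorem1p6 :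
    -- every instance of the construction works
    (∀ (m : ℕ), 2 ≤ m →
      ∀ (F : Type u) [Field F] [Algebra (ZMod 3) F], Nat.card F = 3 ^ (4 * m) →
      ∀ (S : Submodule (ZMod 3) F), IsSidonSpace S →
      ∀ (s : Fin (2 * m) → F), IsBasisOf s S →
      ∀ (H : Matrix (Fin (2 * m)) (Fin ((3 ^ m + 1) / 2)) (ZMod 3)), IsGoodParityCheck H →
      ∀ (n : ℕ), 4 ≤ n → ∀ (e : Fin n ↪ Fin ((3 ^ m + 1) / 2)),
        Function.Injective (evalPoints s H ∘ e) ∧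
        CorrectsInsDel (rsCode (evalPoints s H ∘ e) 2) (n - 3)) ∧
    -- the ingredients exist explicitly
    (∀ (m : ℕ), 1 ≤ m →
      ∀ (F : Type u) [Field F] [Algebra (ZMod 3) F], Nat.card F = 3 ^ (4 * m) →
        (∀ γ : F, IsRRTElement m γ →
          IsSidonSpace (rrtSpace m γ) ∧ Module.finrank (ZMod 3) (rrtSpace m γ) = 2 * m) ∧
        (∃ g : F, IsPrimitiveRoot g (3 ^ (4 * m) - 1)) ∧
        ∀ g : F, IsPrimitiveRoot g (3 ^ (4 * m) - 1) →
          IsRRTElement m g ∧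
          IsBasisOf (explicitBasis m g) (rrtSpace m g) ∧
          IsGoodParityCheck (explicitMatrix m g) ∧
          ∀ j, evalPoints (explicitBasis m g) (explicitMatrix m g) j =
            betaElt m g ^ (j : ℕ) + betaElt m g ^ (3 * (j : ℕ)) * g) ∧
    -- for every `n ≥ 4` an explicit code of length `n` over a field of order at most `C * n ^ 4`
    (∃ C : ℕ, ∀ n : ℕ, 4 ≤ n →
      ∃ m : ℕ, IsLeast {m : ℕ | n ≤ (3 ^ m + 1) / 2} m ∧ 2 ≤ m ∧ 3 ^ (4 * m) ≤ C * n ^ 4 ∧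
        ∃ hm : n ≤ (3 ^ m + 1) / 2,
        ∀ (F : Type u) [Field F] [Algebra (ZMod 3) F], Nat.card F = 3 ^ (4 * m) →
        ∀ g : F, IsPrimitiveRoot g (3 ^ (4 * m) - 1) →
        ∀ α : Fin n → F,
          α = evalPoints (explicitBasis m g) (explicitMatrix m g) ∘ Fin.castLE hm →
          Function.Injective α ∧ CorrectsInsDel (rsCode α 2) (n - 3)) := by
  have part1 : ∀ (m : ℕ) (F : Type u) [Field F] [Algebra (ZMod 3) F]
      (S : Submodule (ZMod 3) F), IsSidonSpace S → ∀ (s : Fin (2 * m) → F), IsBasisOf s S →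
      ∀ (H : Matrix (Fin (2 * m)) (Fin ((3 ^ m + 1) / 2)) (ZMod 3)), IsGoodParityCheck H →
      ∀ (n : ℕ), 4 ≤ n → ∀ (e : Fin n ↪ Fin ((3 ^ m + 1) / 2)),
        Function.Injective (evalPoints s H ∘ e) ∧
        CorrectsInsDel (rsCode (evalPoints s H ∘ e) 2) (n - 3) :=
    fun m F _ _ S hS s hs H hH n hn e => ⟨(hH.injective_evalPoints hs.1).comp e.injective,
      hS.correctsInsDel hs hH (by omega) e⟩
  have finite : ∀ {m : ℕ} {F : Type u}, Nat.card F = 3 ^ (4 * m) → Finite F := fun hF =>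
    Nat.finite_of_card_ne_zero (by rw [hF]; positivity)
  refine ⟨fun m _ F _ _ _ => part1 m F, fun m hm F _ _ hF => ?_, 6 ^ 4, fun n hn => ?_⟩
  · have := finite hF
    have hex := exists_isPrimitiveRoot_natCard_sub_one F
    rw [hF] at hex
    refine ⟨fun γ hγ => ⟨hγ.isSidonSpace, ?_⟩, hex, fun g hg => ⟨hg.isRRTElement hm,
      isBasisOf_explicitBasis hm hg, isGoodParityCheck_explicitMatrix hm hg,
      evalPoints_explicit hm hg⟩⟩
    obtain ⟨g, hg⟩ := hex
    exact hγ.finrank_rrtSpace (hg.finrank_frobFixedField hm)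
  · obtain ⟨m, hleast, hm, hcard⟩ := exists_isLeast_length hn
    refine ⟨m, hleast, hm, hcard, hleast.1, fun F _ _ hF g hg α hα => ?_⟩
    have := finite hF
    have hm1 : 1 ≤ m := by omega
    rw [hα]
    exact part1 m F _ (hg.isRRTElement hm1).isSidonSpace _ (isBasisOf_explicitBasis hm1 hg) _
      (isGoodParityCheck_explicitMatrix hm1 hg) n hn (Fin.castLEEmb hleast.1)
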